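/- Let $f:\mathbb{R}\to\mathbb{C}$ be a $1$-periodic function with $f\in L^2(0,1)$ and $\int_0^1 f(t)\,dt=0$. Write $\hat f(n)=\int_0^1 f(t)e^{-2\pi i n t}\,dt$ for $n\in\mathbb{Z}$, and let $v_2(n)$ denote the $2$-adic valuation of a nonzero integer $n$, that is, $v_2(n)=k$ if $n=2^k m$ with $m$ odd (put $v_2(0)=0$; since $\hat f(0)=0$ the value is irrelevant). Suppose that there is $\varepsilon>0$ such that $$\sum_{n=-\infty}^{\infty} v_2(n)^{4+\varepsilon}\,|\hat f(n)|^2<\infty .$$ Then there is a $1$-periodic function $g:\mathbb{R}\to\mathbb{C}$ with $g\in L^2(0,1)$ such that $$f(t)=g(t)-g(2t)\quad\text{for almost every } t\in\mathbb{R}$$ if and only if $$\lim_{n\to\infty}\frac1n\int_0^1\Bigl|\sum_{i=0}^{n} f(2^i t)\Bigr|^2dt=0 .$$ -/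

import Mathlib

open MeasureTheory Filter Topology

/-! Let `U` be the isometry `f(t) ↦ f(2t)` of `L²`, `V` its adjoint, `S_n` the ergodic sum. If `f =
g - U g`, then `S_n` telescopes and stays bounded. Conversely, `V ^ i` moves the Fourier coefficient
at `2^i n` to `n`, so the weighted bound gives `‖V ^ i f‖ = O(i⁻²)` and `s = ∑ V ^ i f` converges.
The projection `P = 1 - U V` kills the range of `U`, and `∑_{k<n} ‖P V ^ k S_n‖² ≤ ‖S_n‖²`, where `P
V ^ k S_n` is `P` of a partial sum of `s`. Cesàro averaging yields `‖P s‖² ≤ lim ‖S_n‖² / n = 0`;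
then `s = U V s = U (s - f)`, so `g = f - s` works (`exists_eq_sub_iff_tendsto`). -/

theorem clm_mul_apply {E : Type*} [NormedAddCommGroup E] [NormedSpace ℂ E] (A B : E →L[ℂ] E)
    (x : E) : (A * B) x = A (B x) := rfl

theorem tendsto_norm_sum_pow_sq_of_eq_sub {E : Type*} [NormedAddCommGroup E]
    [NormedSpace ℂ E] {U : E →L[ℂ] E} (hU : ∀ x, ‖U x‖ = ‖x‖) (g : E) :
    Tendsto (fun n : ℕ => 1 / (n : ℝ) * ‖∑ i ∈ Finset.range (n + 1), (U ^ i) (g - U g)‖ ^ 2)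
      atTop (𝓝 0) := by
  have hpow : ∀ n : ℕ, ‖(U ^ n) g‖ = ‖g‖ := fun n => by
    induction n with
    | zero => simp
    | succ n ih => rw [pow_succ', clm_mul_apply, hU, ih]
  have hS : ∀ n : ℕ, ∑ i ∈ Finset.range n, (U ^ i) (g - U g) = g - (U ^ n) g := fun n => by
    simpa [pow_succ] using Finset.sum_range_sub' (fun i => (U ^ i) g) n
  have hlim : Tendsto (fun n : ℕ => 1 / (n : ℝ) * (2 * ‖g‖) ^ 2) atTop (𝓝 0) := by
    simpa only [zero_mul] using
      (tendsto_one_div_atTop_nhds_zero_nat (𝕜 := ℝ)).mul_const ((2 * ‖g‖) ^ 2)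
  refine squeeze_zero (fun n => by positivity) (fun n => ?_) hlim
  gcongr
  rw [hS]
  refine (norm_sub_le _ _).trans (by rw [hpow]; linarith)

/-! ### Coboundaries of a Hilbert space isometry -/

section Isometry

open ContinuousLinearMap

variable {H : Type*} [NormedAddCommGroup H] [InnerProductSpace ℂ H] [CompleteSpace H]

/-- For an isometry `U`, the projection `1 - U U†` satisfies the Pythagorean identity. -/
theorem norm_sub_apply_adjoint_sq {U : H →L[ℂ] H} (hU : ∀ x, adjoint U (U x) = x) (x : H) :
    ‖x - U (adjoint U x)‖ ^ 2 = ‖x‖ ^ 2 - ‖adjoint U x‖ ^ 2 := by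
  have h1 : ‖U (adjoint U x)‖ ^ 2 = ‖adjoint U x‖ ^ 2 := by
    rw [← inner_self_eq_norm_sq (𝕜 := ℂ), ← inner_self_eq_norm_sq (𝕜 := ℂ),
      ← adjoint_inner_left, hU]
  have h2 : RCLike.re (inner ℂ x (U (adjoint U x))) = ‖adjoint U x‖ ^ 2 := by
    rw [← adjoint_inner_left, inner_self_eq_norm_sq]
  rw [@norm_sub_sq ℂ, h1, h2]
  ring

/-- By Pythagoras each term is `‖V ^ k x‖² - ‖V ^ (k+1) x‖²` with `V = adjoint U`, so the sum
telescopes. -/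
theorem sum_norm_sub_apply_adjoint_sq_le {U : H →L[ℂ] H} (hU : ∀ x, adjoint U (U x) = x)
    (x : H) (n : ℕ) :
    ∑ k ∈ Finset.range n, ‖(adjoint U ^ k) x - U (adjoint U ((adjoint U ^ k) x))‖ ^ 2
      ≤ ‖x‖ ^ 2 := by
  have h : ∑ k ∈ Finset.range n, ‖(adjoint U ^ k) x - U (adjoint U ((adjoint U ^ k) x))‖ ^ 2
      = ‖x‖ ^ 2 - ‖(adjoint U ^ n) x‖ ^ 2 := by
    induction n with
    | zero => simp
    | succ n ih =>
      rw [Finset.sum_range_succ, ih, norm_sub_apply_adjoint_sq hU, pow_succ' _ n, clm_mul_apply]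
      ring
  rw [h]
  nlinarith [sq_nonneg ‖(adjoint U ^ n) x‖]

/-- Up to the range of `U`, the `k`-th backward iterate of a long sum of forward iterates of `f`
is a sum of backward iterates of `f`. -/
theorem exists_adjoint_pow_sum_pow_eq {U : H →L[ℂ] H} (hU : ∀ x, adjoint U (U x) = x)
    (f : H) (k : ℕ) : ∀ n, k ≤ n → ∃ y,
      (adjoint U ^ k) (∑ i ∈ Finset.range (n + 1), (U ^ i) f)
        = ∑ j ∈ Finset.range (k + 1), (adjoint U ^ j) f + U y := by
  have hS : ∀ n, ∑ i ∈ Finset.range (n + 1), (U ^ i) f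
      = f + U (∑ i ∈ Finset.range n, (U ^ i) f) := fun n => by
    rw [Finset.sum_range_succ', map_sum, add_comm]
    simp [pow_succ', -map_sum]
  induction k with
  | zero => exact fun n _ => ⟨∑ i ∈ Finset.range n, (U ^ i) f, by rw [hS]; simp⟩
  | succ k ih =>
    intro n hn
    obtain ⟨m, rfl⟩ : ∃ m, n = m + 1 := ⟨n - 1, by omega⟩
    obtain ⟨y, hy⟩ := ih m (by omega)
    -- The same `y` serves, since `V (f + U S) = V f + S`.
    refine ⟨y, ?_⟩
    rw [hS, pow_succ, clm_mul_apply, map_add, hU, map_add, hy, Finset.sum_range_succ _ (k + 1),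
      pow_succ, clm_mul_apply]
    abel

/-- If the backward iterates of `f` under an isometry `U` are summable, then `f` is a coboundary
iff the variance of its ergodic sums grows sublinearly. -/
theorem exists_eq_sub_iff_tendsto {U : H →L[ℂ] H} (hU : ∀ x, ‖U x‖ = ‖x‖) {f : H}
    (hf : Summable fun i : ℕ => (adjoint U ^ i) f) :
    (∃ g, f = g - U g) ↔
      Tendsto (fun n : ℕ => 1 / (n : ℝ) * ‖∑ i ∈ Finset.range (n + 1), (U ^ i) f‖ ^ 2)
        atTop (𝓝 0) := by
  refine ⟨fun ⟨g, hg⟩ => hg ▸ tendsto_norm_sum_pow_sq_of_eq_sub hU g, fun h => ?_⟩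
  have hU' : ∀ x, adjoint U (U x) = x := fun x =>
    DFunLike.congr_fun ((norm_map_iff_adjoint_comp_self U).1 hU) x
  set s := ∑' i : ℕ, (adjoint U ^ i) f with hs
  have hVs : adjoint U s = s - f := by
    rw [hs, (adjoint U).map_tsum hf, hf.tsum_eq_zero_add]
    simp [pow_succ']
  have hces : Tendsto (fun n : ℕ => (n : ℝ)⁻¹ * ∑ k ∈ Finset.range n,
      ‖∑ j ∈ Finset.range (k + 1), (adjoint U ^ j) f
        - U (adjoint U (∑ j ∈ Finset.range (k + 1), (adjoint U ^ j) f))‖ ^ 2) atTop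
      (𝓝 (‖s - U (adjoint U s)‖ ^ 2)) := by
    refine Tendsto.cesaro (Tendsto.pow (Tendsto.norm ?_) 2)
    have hlim := (hf.hasSum.tendsto_sum_nat).comp (tendsto_add_atTop_nat 1)
    exact hlim.sub (((U.continuous.comp (adjoint U).continuous).tendsto s).comp hlim)
  have hle : ‖s - U (adjoint U s)‖ ^ 2 ≤ 0 := by
    refine le_of_tendsto_of_tendsto' hces h fun n => ?_
    rw [one_div]
    gcongr
    refine le_trans (Finset.sum_le_sum fun k hk => le_of_eq ?_)
      (sum_norm_sub_apply_adjoint_sq_le hU' _ n)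
    obtain ⟨y, hy⟩ := exists_adjoint_pow_sum_pow_eq hU' f k n (Finset.mem_range.1 hk).le
    rw [hy]
    simp only [map_add, hU']
    congr 2
    abel
  have hzero : s - U (adjoint U s) = 0 := by
    simpa using le_antisymm hle (by positivity)
  refine ⟨f - s, ?_⟩
  rw [hVs, map_sub] at hzero
  rw [map_sub, ← sub_eq_zero, ← hzero]
  abel

end Isometry

/-! ### The doubling map and Fourier coefficients -/

section UnitCircle

open AddCircle

theorem UnitAddCircle.volume_eq_haarAddCircle :
    (volume : Measure UnitAddCircle) = haarAddCircle := by
  simp [volume_eq_smul_haarAddCircle]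

theorem measurePreserving_two_nsmul_haarAddCircle :
    MeasurePreserving (fun x : UnitAddCircle => 2 • x) haarAddCircle haarAddCircle := by
  rw [← UnitAddCircle.volume_eq_haarAddCircle]
  exact (AddCircle.ergodic_nsmul one_lt_two).toMeasurePreserving

/-- The Koopman operator of the doubling map on the unit circle. -/
noncomputable def doublingOperator :
    Lp ℂ 2 (haarAddCircle : Measure UnitAddCircle) →L[ℂ]
      Lp ℂ 2 (haarAddCircle : Measure UnitAddCircle) :=
  (Lp.compMeasurePreservingₗᵢ ℂ (fun x : UnitAddCircle => 2 • x)
    measurePreserving_two_nsmul_haarAddCircle).toContinuousLinearMap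

theorem norm_doublingOperator (F : Lp ℂ 2 (haarAddCircle : Measure UnitAddCircle)) :
    ‖doublingOperator F‖ = ‖F‖ :=
  LinearIsometry.norm_map _ F

theorem coeFn_doublingOperator (F : Lp ℂ 2 (haarAddCircle : Measure UnitAddCircle)) :
    doublingOperator F =ᵐ[haarAddCircle] fun x => F (2 • x) :=
  Lp.coeFn_compMeasurePreserving F measurePreserving_two_nsmul_haarAddCircle

theorem doublingOperator_fourierLp (n : ℤ) :
    doublingOperator (fourierLp 2 n) = fourierLp 2 (2 * n) := by
  refine Lp.ext ?_
  filter_upwards [coeFn_doublingOperator (fourierLp 2 n), coeFn_fourierLp (T := 1) 2 (2 * n),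
    measurePreserving_two_nsmul_haarAddCircle.quasiMeasurePreserving.ae
      (coeFn_fourierLp (T := 1) 2 n)] with x h1 h2 h3
  rw [h1, h2, h3, fourier_apply, fourier_apply, mul_comm, mul_smul]
  norm_cast

theorem doublingOperator_pow_fourierLp (i : ℕ) (n : ℤ) :
    (doublingOperator ^ i) (fourierLp 2 n) = fourierLp 2 (2 ^ i * n) := by
  induction i with
  | zero => simp
  | succ i ih =>
    rw [pow_succ', clm_mul_apply, ih, doublingOperator_fourierLp, pow_succ',
      mul_assoc]

theorem fourierCoeff_adjoint_doublingOperator_pow (i : ℕ)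
    (F : Lp ℂ 2 (haarAddCircle : Measure UnitAddCircle)) (n : ℤ) :
    fourierCoeff ((ContinuousLinearMap.adjoint doublingOperator ^ i) F) n
      = fourierCoeff F (2 ^ i * n) := by
  rw [← fourierBasis_repr, ← fourierBasis_repr, HilbertBasis.repr_apply_apply,
    HilbertBasis.repr_apply_apply, coe_fourierBasis, ← doublingOperator_pow_fourierLp,
    ← ContinuousLinearMap.star_eq_adjoint, ← star_pow, ContinuousLinearMap.star_eq_adjoint,
    ContinuousLinearMap.adjoint_inner_right]

theorem hasSum_norm_sq_fourierCoeff (F : Lp ℂ 2 (haarAddCircle : Measure UnitAddCircle)) :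
    HasSum (fun n => ‖fourierCoeff F n‖ ^ 2) (‖F‖ ^ 2) := by
  simp_rw [← fourierBasis_repr]
  rw [← LinearIsometryEquiv.norm_map (fourierBasis (T := 1)).repr F]
  exact_mod_cast lp.hasSum_norm (by simp) (fourierBasis.repr F)

theorem pow_le_padicValInt_pow_mul {n : ℤ} (hn : n ≠ 0) (i : ℕ) :
    i ≤ padicValInt 2 (2 ^ i * n) := by
  have h : padicValInt 2 ((2 : ℤ) ^ i) = i := by
    have := padicValInt.of_nat (p := 2) (n := 2 ^ i)
    simpa using this
  rw [padicValInt.mul (by positivity) hn, h]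
  omega

theorem summable_adjoint_doublingOperator_pow
    {F : Lp ℂ 2 (haarAddCircle : Measure UnitAddCircle)} (h0 : fourierCoeff F 0 = 0)
    {ε : ℝ} (hε : 0 < ε)
    (hF : Summable fun n : ℤ => (padicValInt 2 n : ℝ) ^ (4 + ε) * ‖fourierCoeff F n‖ ^ 2) :
    Summable fun i : ℕ => (ContinuousLinearMap.adjoint doublingOperator ^ i) F := by
  set B := ∑' n : ℤ, (padicValInt 2 n : ℝ) ^ (4 + ε) * ‖fourierCoeff F n‖ ^ 2 with hB
  have hB0 : 0 ≤ B := tsum_nonneg fun n => by positivity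
  have key (i : ℕ) (hi : 1 ≤ i) :
      (i : ℝ) ^ 4 * ‖(ContinuousLinearMap.adjoint doublingOperator ^ i) F‖ ^ 2 ≤ B := by
    have hinj : Function.Injective fun n : ℤ => 2 ^ i * n :=
      mul_right_injective₀ (by positivity)
    have hs := (hasSum_norm_sq_fourierCoeff
      ((ContinuousLinearMap.adjoint doublingOperator ^ i) F)).mul_left ((i : ℝ) ^ 4)
    simp only [fourierCoeff_adjoint_doublingOperator_pow] at hs
    rw [← hs.tsum_eq]
    refine (hs.summable.tsum_le_tsum (fun n => ?_) (hF.comp_injective hinj)).trans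
      (tsum_comp_le_tsum_of_inj hF (fun n => by positivity) hinj)
    rcases eq_or_ne n 0 with rfl | hn
    · simp [h0]
    · have h1 : (i : ℝ) ≤ padicValInt 2 (2 ^ i * n) := by
        exact_mod_cast pow_le_padicValInt_pow_mul hn i
      -- A base of at least `1` lets the exponent `4 + ε` drop to `4`; this is where `1 ≤ i` enters.
      have h2 : (1 : ℝ) ≤ padicValInt 2 (2 ^ i * n) := le_trans (by exact_mod_cast hi) h1
      simp only [Function.comp_apply]
      gcongr
      calc (i : ℝ) ^ 4 ≤ (padicValInt 2 (2 ^ i * n) : ℝ) ^ 4 := by gcongr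
        _ = (padicValInt 2 (2 ^ i * n) : ℝ) ^ (4 : ℝ) := by norm_cast
        _ ≤ _ := Real.rpow_le_rpow_of_exponent_le h2 (by linarith)
  refine Summable.of_norm_bounded_eventually_nat
    (g := fun i : ℕ => √B * (1 / (i : ℝ) ^ 2)) ?_ ?_
  · exact (Real.summable_one_div_nat_pow.2 one_lt_two).mul_left _
  · filter_upwards [eventually_ge_atTop 1] with i hi
    have hi' : (0 : ℝ) < (i : ℝ) ^ 2 := by positivity
    rw [mul_one_div, le_div_iff₀ hi']
    refine Real.le_sqrt_of_sq_le ((le_of_eq ?_).trans (key i hi))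
    ring

/-! ### Transfer between the circle and periodic functions on the line -/

theorem UnitAddCircle.ae_coe {P : UnitAddCircle → Prop}
    (h : ∀ᵐ x ∂(haarAddCircle : Measure UnitAddCircle), P x) : ∀ᵐ t : ℝ, P (t : UnitAddCircle) := by
  rw [← UnitAddCircle.volume_eq_haarAddCircle] at h
  rw [← Measure.restrict_univ (μ := (volume : Measure ℝ)), ← iUnion_Ioc_intCast ℝ,
    ae_restrict_iUnion_iff]
  exact fun n => (UnitAddCircle.measurePreserving_mk (n : ℝ)).quasiMeasurePreserving.ae h

theorem ae_comp_two_mul {P : ℝ → Prop} (h : ∀ᵐ t : ℝ, P t) : ∀ᵐ t : ℝ, P (2 * t) := by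
  have hq : Measure.QuasiMeasurePreserving (fun t : ℝ => 2 * t) volume volume := by
    refine ⟨measurable_const_mul 2, ?_⟩
    rw [Real.map_volume_mul_left two_ne_zero]
    exact Measure.smul_absolutelyContinuous
  exact hq.ae h

theorem doublingOperator_coe_ae_eq {F : Lp ℂ 2 (haarAddCircle : Measure UnitAddCircle)}
    {f : ℝ → ℂ} (h : ∀ᵐ t : ℝ, F (t : UnitAddCircle) = f t) :
    ∀ᵐ t : ℝ, doublingOperator F (t : UnitAddCircle) = f (2 * t) := by
  filter_upwards [UnitAddCircle.ae_coe (coeFn_doublingOperator F), ae_comp_two_mul h]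
    with t h1 h2
  rw [h1, ← h2, ← AddCircle.coe_nsmul, nsmul_eq_mul, Nat.cast_ofNat]

theorem doublingOperator_pow_coe_ae_eq {F : Lp ℂ 2 (haarAddCircle : Measure UnitAddCircle)}
    {f : ℝ → ℂ} (h : ∀ᵐ t : ℝ, F (t : UnitAddCircle) = f t) (i : ℕ) :
    ∀ᵐ t : ℝ, (doublingOperator ^ i) F (t : UnitAddCircle) = f (2 ^ i * t) := by
  induction i with
  | zero => simpa using h
  | succ i ih =>
    rw [pow_succ', clm_mul_apply]
    filter_upwards [doublingOperator_coe_ae_eq ih] with t ht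
    rw [ht, pow_succ, mul_assoc]

theorem sum_doublingOperator_pow_coe_ae_eq {F : Lp ℂ 2 (haarAddCircle : Measure UnitAddCircle)}
    {f : ℝ → ℂ} (h : ∀ᵐ t : ℝ, F (t : UnitAddCircle) = f t) (n : ℕ) :
    ∀ᵐ t : ℝ, (∑ i ∈ Finset.range n, (doublingOperator ^ i) F) (t : UnitAddCircle)
      = ∑ i ∈ Finset.range n, f (2 ^ i * t) := by
  induction n with
  | zero =>
    filter_upwards with t
    simp
  | succ n ih =>
    rw [Finset.sum_range_succ]
    filter_upwards [ih, doublingOperator_pow_coe_ae_eq h n, UnitAddCircle.ae_coe (Lp.coeFn_add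
      (∑ i ∈ Finset.range n, (doublingOperator ^ i) F) ((doublingOperator ^ n) F))] with t h1 h2 h3
    rw [h3, Pi.add_apply, h1, h2, Finset.sum_range_succ]

theorem norm_sq_eq_intervalIntegral {F : Lp ℂ 2 (haarAddCircle : Measure UnitAddCircle)}
    {f : ℝ → ℂ} (h : ∀ᵐ t : ℝ, F (t : UnitAddCircle) = f t) :
    ‖F‖ ^ 2 = ∫ t in (0 : ℝ)..1, ‖f t‖ ^ 2 := by
  rw [(hasSum_norm_sq_fourierCoeff F).unique (hasSum_sq_fourierCoeff F),
    integral_haarAddCircle, inv_one, one_smul,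
    ← UnitAddCircle.intervalIntegral_preimage 0, zero_add]
  refine intervalIntegral.integral_congr_ae ?_
  filter_upwards [h] with t ht _
  rw [ht]

theorem fourierCoeff_eq_fourierCoeffOn_of_ae {F : Lp ℂ 2 (haarAddCircle : Measure UnitAddCircle)}
    {f : ℝ → ℂ} (h : ∀ᵐ t : ℝ, F (t : UnitAddCircle) = f t) (n : ℤ) :
    fourierCoeff F n = fourierCoeffOn (zero_lt_one' ℝ) f n := by
  rw [fourierCoeff_eq_intervalIntegral _ _ 0, fourierCoeffOn_eq_integral, sub_zero, zero_add]
  congr 1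
  refine intervalIntegral.integral_congr_ae ?_
  filter_upwards [h] with t ht _
  rw [ht, fourier_coe_apply]

theorem exists_Lp_coe_ae_eq {f : ℝ → ℂ} (hper : Function.Periodic f 1)
    (hL2 : MemLp f 2 (volume.restrict (Set.Ioo (0 : ℝ) 1))) :
    ∃ F : Lp ℂ 2 (haarAddCircle : Measure UnitAddCircle),
      ∀ᵐ t : ℝ, F (t : UnitAddCircle) = f t := by
  rw [Measure.restrict_congr_set Ioo_ae_eq_Ioc, ← zero_add (1 : ℝ)] at hL2
  have hlift := hL2.memLp_liftIoc (T := 1).haarAddCircle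
  refine ⟨hlift.toLp, ?_⟩
  filter_upwards [UnitAddCircle.ae_coe hlift.coeFn_toLp] with t ht
  rw [ht, ← hper.lift_coe t, ← AddCircle.coe_equivIoc (p := 1) (a := 0) (y := (t : UnitAddCircle)),
    hper.lift_coe]
  simp [liftIoc]

theorem Lp_ext_of_coe_ae_eq {F G : Lp ℂ 2 (haarAddCircle : Measure UnitAddCircle)}
    (h : ∀ᵐ t : ℝ, F (t : UnitAddCircle) = G (t : UnitAddCircle)) : F = G := by
  have h0 : ‖F - G‖ ^ 2 = 0 := by
    rw [norm_sq_eq_intervalIntegral (f := fun _ => 0)]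
    · simp
    · filter_upwards [h, UnitAddCircle.ae_coe (Lp.coeFn_sub F G)] with t h1 h2
      rw [h2, Pi.sub_apply, h1, sub_self]
  simpa [sub_eq_zero] using h0

theorem memLp_coe (G : Lp ℂ 2 (haarAddCircle : Measure UnitAddCircle)) :
    MemLp (fun t : ℝ => G (t : UnitAddCircle)) 2 (volume.restrict (Set.Ioo (0 : ℝ) 1)) := by
  have h := UnitAddCircle.measurePreserving_mk 0
  rw [UnitAddCircle.volume_eq_haarAddCircle, zero_add] at h
  rw [Measure.restrict_congr_set Ioo_ae_eq_Ioc]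
  exact (Lp.memLp G).comp_measurePreserving h

end UnitCircle

theorem corollary4p1 (f : ℝ → ℂ)
    (hper : Function.Periodic f 1)
    (hL2 : MemLp f 2 (volume.restrict (Set.Ioo (0 : ℝ) 1)))
    (hmean : ∫ t in (0 : ℝ)..1, f t = 0)
    (ε : ℝ) (hε : 0 < ε)
    (hsum : Summable fun n : ℤ =>
      (padicValInt 2 n : ℝ) ^ (4 + ε) * ‖fourierCoeffOn (zero_lt_one' ℝ) f n‖ ^ 2) :
    (∃ g : ℝ → ℂ, Function.Periodic g 1 ∧
        MemLp g 2 (volume.restrict (Set.Ioo (0 : ℝ) 1)) ∧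
        ∀ᵐ t : ℝ, f t = g t - g (2 * t)) ↔
      Tendsto (fun n : ℕ =>
          1 / (n : ℝ) *
            ∫ t in (0 : ℝ)..1, ‖∑ i ∈ Finset.range (n + 1), f (2 ^ i * t)‖ ^ 2)
        atTop (𝓝 0) := by
  obtain ⟨F, hF⟩ := exists_Lp_coe_ae_eq hper hL2
  have h0 : fourierCoeff F 0 = 0 := by
    rw [fourierCoeff_eq_fourierCoeffOn_of_ae hF, fourierCoeffOn_eq_integral]
    simpa using hmean
  simp only [← fourierCoeff_eq_fourierCoeffOn_of_ae hF] at hsum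
  simp only [← norm_sq_eq_intervalIntegral (sum_doublingOperator_pow_coe_ae_eq hF _)]
  rw [← exists_eq_sub_iff_tendsto norm_doublingOperator
    (summable_adjoint_doublingOperator_pow h0 hε hsum)]
  constructor
  · rintro ⟨g, hgper, hg, hfg⟩
    obtain ⟨G, hG⟩ := exists_Lp_coe_ae_eq hgper hg
    refine ⟨G, Lp_ext_of_coe_ae_eq ?_⟩
    filter_upwards [hF, hG, doublingOperator_coe_ae_eq hG, hfg,
      UnitAddCircle.ae_coe (Lp.coeFn_sub G (doublingOperator G))] with t h1 h2 h3 h4 h5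
    rw [h1, h4, h5, Pi.sub_apply, h2, h3]
  · rintro ⟨G, hG⟩
    refine ⟨fun t => G (t : UnitAddCircle), fun t => by simp, memLp_coe G, ?_⟩
    have hUG := doublingOperator_coe_ae_eq (F := G) (f := fun t => G (t : UnitAddCircle))
      (ae_of_all _ fun _ => rfl)
    filter_upwards [hF, hUG, UnitAddCircle.ae_coe (Lp.coeFn_sub G (doublingOperator G))]
      with t h1 h2 h3
    rw [← h1, hG, h3, Pi.sub_apply, h2]
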